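/- All graphs are finite and simple, $\log$ is the natural logarithm, and $d(H)=2|E(H)|/|V(H)|$ denotes the average degree of a graph $H$ with at least one vertex. For a graph $G$, let $$c_{1/5}(G)=\min\{|V(H)| : H\subseteq G \text{ is a subgraph with at least one vertex and } d(H)\ge \tfrac15 d(G)\}.$$ A set $A\subseteq V(G)$ is a Hamiltonian subset of $G$ if the induced subgraph $G[A]$ contains a Hamiltonian cycle, and $h(G)$ denotes the number of Hamiltonian subsets of $G$. Theorem. There exist constants $B>0$ and $d_0$ such that the following is true. Let $G$ be an $n$-vertex graph with average degree $d\ge d_0$, let $t=c_{1/5}(G)$ and $\beta=(6000\log 3)^{-16}$. Then $$h(G)\ \ge\ \frac1B\, n\, 2^{\beta t/\log^{16} t},$$ where $\log^{16}t=(\log t)^{16}$. -/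

import Mathlib

namespace SimpleGraph

/-- The average degree `d(G) = 2 e(G) / |V(G)|` of a (finite) graph. -/
noncomputable def avgDegree {V : Type*} (G : SimpleGraph V) : ℝ :=
  2 * (G.edgeSet.ncard : ℝ) / (Nat.card V : ℝ)

/-- A subgraph `H` of `G` (not necessarily induced or spanning, with at least one vertex) is an
`α`-crux of `G` if `d(H) ≥ α · d(G)`. -/
def IsCrux {V : Type*} (G : SimpleGraph V) (α : ℝ) (H : G.Subgraph) : Prop :=
  H.verts.Nonempty ∧ α * G.avgDegree ≤ H.coe.avgDegree

/-- The crux function `c_α(G)`: the smallest number of vertices of an `α`-crux of `G`. For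
`0 < α < 1` and `G` finite with at least one vertex the set below contains the order of `G`. -/
noncomputable def cruxSize {V : Type*} (G : SimpleGraph V) (α : ℝ) : ℕ :=
  sInf {k : ℕ | ∃ H : G.Subgraph, G.IsCrux α H ∧ H.verts.ncard = k}

open Classical in
/-- A set `A` of vertices is a Hamiltonian subset of `G` if the induced subgraph `G[A]` contains a
Hamiltonian cycle. (In particular `A` has at least three elements.) -/
def IsHamiltonianSubset {V : Type*} (G : SimpleGraph V) (A : Set V) : Prop :=
  ∃ (a : A) (p : (G.induce A).Walk a a), p.IsHamiltonianCycle

/-- The number `h(G)` of Hamiltonian subsets of a finite graph `G`. -/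
noncomputable def numHamiltonianSubsets {V : Type*} (G : SimpleGraph V) : ℕ :=
  {A : Set V | G.IsHamiltonianSubset A}.ncard

end SimpleGraph

open Finset
open scoped Classical

namespace SimpleGraph

variable {V : Type*}

/-! The proof gives the stronger bound `n * 2 ^ (t / 12) / 12800`; the logarithmic factor is only
discarded at the end.

Sets inducing average degree at least `d / 5` have at least `t` vertices. Hence a set inducing
average degree above `2 * d / 5` has a subset in which all sets of order between about `t / 3` and
`2 * t / 3` expand, and a search in the style of depth-first search then finds a cycle on at least
`t / 3` vertices (`exists_long_cycle_of_dense`).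

A uniformly random vertex set `U` typically induces average degree about `d / 2 > 2 * d / 5`, so a
positive proportion of all `U` contain such a cycle. If degrees are at most `d * Φ`, this survives
the deletion of a small multiple of `n / Φ` vertices, so `U` contains at least of order `n / Φ`
vertex sets of long cycles. Each of these lies in at most a `2 ^ (-t / 3)` fraction of all `U`, and
double counting yields of order `2 ^ (t / 3) * n / Φ` Hamiltonian subsets
(`card_hamiltonianSubsets_of_sparse`).

With `Φ = 2 ^ (t / 12)`, let `T` be the vertices of degree above `d * Φ`. If `T` spans few edges,
these are deleted, so that every cycle leaves `T`. Otherwise `T` is tiny and induces a far denser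
graph, and induction on the order applies to it. -/

/-! ### Long cycles from expansion. -/

/-- The neighbours in `S` of the set `X`, outside `X`. -/
noncomputable def outerNeighbors (F : SimpleGraph V) (S X : Finset V) : Finset V :=
  {y ∈ S | y ∉ X ∧ ∃ x ∈ X, F.Adj x y}

/-- Any nonempty subset of the support of a path is contained in an initial segment of the path
that ends in a vertex of this subset. -/
theorem Walk.IsPath.exists_initial_segment {F : SimpleGraph V} {v r : V} {p : F.Walk v r}
    (hp : p.IsPath) (N : Finset V) (hN : N.Nonempty) (hNp : ∀ x ∈ N, x ∈ p.support) :
    ∃ u ∈ N, ∃ q : F.Walk v u, q.IsPath ∧ (∀ x ∈ N, x ∈ q.support) ∧ q.support ⊆ p.support := by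
  induction p generalizing N with
  | nil =>
    obtain ⟨u, hu⟩ := hN
    have := hNp u hu
    simp only [Walk.support_nil, List.mem_singleton] at this
    subst this
    exact ⟨_, hu, Walk.nil, Walk.IsPath.nil, hNp, fun _ h => h⟩
  | @cons a b c h p ih =>
    rw [Walk.cons_isPath_iff] at hp
    by_cases hne : (N.erase a).Nonempty
    · obtain ⟨u, hu, q, hq, hNq, hqp⟩ := ih hp.1 (N.erase a) hne (fun x hx => by
        have := hNp x (mem_of_mem_erase hx)
        rw [Walk.support_cons, List.mem_cons] at this
        exact this.resolve_left (ne_of_mem_erase hx))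
      refine ⟨u, mem_of_mem_erase hu, Walk.cons h q, ?_, fun x hx => ?_, ?_⟩
      · rw [Walk.cons_isPath_iff]
        exact ⟨hq, fun ha => hp.2 (hqp ha)⟩
      · by_cases hxa : x = a
        · simp [hxa]
        · rw [Walk.support_cons, List.mem_cons]
          exact Or.inr (hNq x (mem_erase.2 ⟨hxa, hx⟩))
      · rw [Walk.support_cons, Walk.support_cons]
        exact List.cons_subset_cons _ hqp
    · rw [not_nonempty_iff_eq_empty, erase_eq_empty_iff] at hne
      have hNa : N = {a} := hne.resolve_left hN.ne_empty
      subst hNa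
      exact ⟨a, mem_singleton_self a, Walk.nil, Walk.IsPath.nil, by simp, by simp⟩

/-- Two disjoint paths with adjacent ends on both sides close up to a cycle. -/
theorem Walk.IsPath.exists_isCycle_of_disjoint {F : SimpleGraph V} {v u w x : V}
    {p : F.Walk v u} {q : F.Walk w x} (hp : p.IsPath) (hq : q.IsPath)
    (hpq : ∀ z ∈ p.support, z ∉ q.support) (huv : v ≠ u) (huw : F.Adj u w) (hvx : F.Adj v x) :
    ∃ c : F.Walk x x, c.IsCycle ∧ ∀ z, z ∈ c.support ↔ z ∈ p.support ∨ z ∈ q.support := by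
  refine ⟨Walk.cons hvx.symm (p.append (Walk.cons huw q)), ?_, fun z => ?_⟩
  · rw [Walk.cons_isCycle_iff]
    constructor
    · rw [Walk.isPath_def, Walk.support_append, Walk.support_cons, List.tail_cons,
        List.nodup_append']
      exact ⟨hp.support_nodup, hq.support_nodup, fun z hz => hpq z hz⟩
    · rw [Walk.edges_append, Walk.edges_cons, List.mem_append, List.mem_cons]
      rintro (h | h | h)
      · exact hpq x (p.fst_mem_support_of_mem_edges h) q.end_mem_support
      · rw [Sym2.eq_iff] at h
        rcases h with ⟨h, -⟩ | ⟨-, h⟩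
        · exact hpq u p.end_mem_support (h ▸ q.end_mem_support)
        · exact huv h
      · exact hpq v p.start_mem_support (q.snd_mem_support_of_mem_edges h)
  · rw [Walk.support_cons, Walk.support_append, Walk.support_cons, List.tail_cons, List.mem_cons,
      List.mem_append]
    constructor
    · rintro (rfl | h)
      · exact Or.inr q.end_mem_support
      · exact h
    · exact Or.inr

/-- Every component of `F[W]` contains a neighbour of `v`. -/
def TouchesComponents (F : SimpleGraph V) (v : V) (W : Finset V) : Prop :=
  ∀ X ⊆ W, X.Nonempty → (∀ x ∈ X, ∀ y ∈ W, F.Adj x y → y ∈ X) → ∃ x ∈ X, F.Adj v x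

/-- The vertices reachable from `w` inside `W` are closed under adjacency in `W`, so `v` has a
neighbour among them. -/
theorem TouchesComponents.exists_path {F : SimpleGraph V} {v : V} {W : Finset V}
    (h : F.TouchesComponents v W) {w : V} (hw : w ∈ W) :
    ∃ x ∈ W, F.Adj v x ∧ ∃ q : F.Walk w x, q.IsPath ∧ ∀ z ∈ q.support, z ∈ W := by
  obtain ⟨x, hx, hvx⟩ := h {x ∈ W | ∃ q : F.Walk w x, ∀ z ∈ q.support, z ∈ W}
    (filter_subset _ _) ⟨w, mem_filter.2 ⟨hw, Walk.nil, by simpa using hw⟩⟩ (by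
      intro x hx y hy hxy
      obtain ⟨hx, q, hq⟩ := mem_filter.1 hx
      refine mem_filter.2 ⟨hy, q.concat hxy, fun z hz => ?_⟩
      rw [Walk.support_concat, List.mem_append, List.mem_singleton] at hz
      rcases hz with hz | rfl
      · exact hq z hz
      · exact hy)
  obtain ⟨hx, q, hq⟩ := mem_filter.1 hx
  exact ⟨x, hx, hvx, q.bypass, q.bypass_isPath, fun z hz => hq z (q.support_bypass_subset_support hz)⟩

/-- If all sets of order between `k` and `2k` have at least `s` outer neighbours, then there is a
cycle on at least `s` vertices. -/
theorem exists_long_cycle [Fintype V] (F : SimpleGraph V) (S : Finset V) (k s : ℕ) (hs : 2 ≤ s)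
    (hS : k ≤ #S)
    (hexp : ∀ X ⊆ S, k ≤ #X → #X ≤ 2 * k → s ≤ #(F.outerNeighbors S X)) :
    ∃ (v : V) (c : F.Walk v v), c.IsCycle ∧ (∀ x ∈ c.support, x ∈ S) ∧
      s ≤ #c.support.toFinset := by
  -- State of a search: `W` is unexplored, the path is the current stack with top `v`, and all outer
  -- neighbours of `W` lie on the stack. The alternative of no outer neighbours is the start, with
  -- an empty stack.
  let Inv : Finset V → Prop := fun W => W ⊆ S ∧ k ≤ #W ∧
    (F.outerNeighbors S W = ∅ ∨ ∃ (v r : V) (p : F.Walk v r), p.IsPath ∧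
      (∀ x ∈ p.support, x ∈ S ∧ x ∉ W) ∧ (∀ x ∈ F.outerNeighbors S W, x ∈ p.support) ∧
      F.TouchesComponents v W)
  have hInvS : Inv S := by
    refine ⟨Subset.refl _, hS, Or.inl ?_⟩
    ext y
    simp +contextual [outerNeighbors]
  obtain ⟨W, hW, hmin⟩ := exists_min_image (univ.filter Inv) card ⟨S, by simpa using hInvS⟩
  simp only [mem_filter, mem_univ, true_and] at hW hmin
  obtain ⟨hWS, hkW, hWp⟩ := hW
  -- a minimal such set is small
  have hsmall : #W ≤ 2 * k := by
    by_contra! hbig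
    -- If `F[W]` is disconnected, it splits into two parts without edges between them; one has at
    -- least `k` vertices and can replace `W` with the same stack.
    by_cases hconn : ∃ X ⊆ W, X.Nonempty ∧ X ≠ W ∧ ∀ x ∈ X, ∀ y ∈ W, F.Adj x y → y ∈ X
    · obtain ⟨X, hXW, hXne, hXW', hX⟩ := hconn
      have hpart : ∀ Y ⊆ W, Y ≠ W → (∀ x ∈ Y, ∀ y ∈ W, F.Adj x y → y ∈ Y) → #Y < k := by
        intro Y hYW hYW' hY
        by_contra! hkY
        have hlt : #Y < #W := card_lt_card (hYW.ssubset_of_ne hYW')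
        have hout : F.outerNeighbors S Y ⊆ F.outerNeighbors S W := by
          intro y hy
          simp only [outerNeighbors, mem_filter] at hy ⊢
          obtain ⟨hyS, hyY, x, hx, hxy⟩ := hy
          exact ⟨hyS, fun hyW => hyY (hY x hx y hyW hxy), x, hYW hx, hxy⟩
        refine absurd (hmin Y ⟨hYW.trans hWS, hkY, ?_⟩) (by omega)
        rcases hWp with h | ⟨v, r, p, hp, hpW, hNp, hv⟩
        · exact Or.inl (subset_empty.1 (h ▸ hout))
        · refine Or.inr ⟨v, r, p, hp, fun x hx => ⟨(hpW x hx).1, fun h => (hpW x hx).2 (hYW h)⟩,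
            fun x hx => hNp x (hout hx), fun Z hZY hZne hZ => hv Z (hZY.trans hYW) hZne ?_⟩
          exact fun x hx y hy hxy => hZ x hx y (hY x (hZY hx) y hy hxy) hxy
      have h1 := hpart X hXW hXW' hX
      have h2 := hpart (W \ X) sdiff_subset
        (fun h => by
          obtain ⟨x, hx⟩ := hXne
          have := hXW hx
          rw [← h, mem_sdiff] at this
          exact this.2 hx)
        (fun x hx y hy hxy => by
          rw [mem_sdiff] at hx ⊢
          exact ⟨hy, fun hyX => hx.2 (hX y hyX x hx.1 hxy.symm)⟩)
      have h3 := card_sdiff_add_card_eq_card hXW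
      omega
    · push Not at hconn
      have hWne : W.Nonempty := card_pos.1 (by omega)
      have htouch : ∀ c ∈ W, F.TouchesComponents c (W.erase c) := by
        intro c hc X hX hXne hXcl
        by_contra! hcX
        have hXW := hX.trans (erase_subset c W)
        obtain ⟨x, hx, y, hy, hxy, hyX⟩ := hconn X hXW hXne
          (fun h => notMem_erase c W (hX (h ▸ hc)))
        by_cases hyc : y = c
        · exact hcX x hx (hyc ▸ hxy.symm)
        · exact hyX (hXcl x hx y (mem_erase.2 ⟨hyc, hy⟩) hxy)
      have hout : ∀ c ∈ W, ∀ y ∈ F.outerNeighbors S (W.erase c),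
          y = c ∨ y ∈ F.outerNeighbors S W := by
        intro c hc y hy
        simp only [outerNeighbors, mem_filter, mem_erase, not_and] at hy ⊢
        obtain ⟨hyS, hyY, x, hx, hxy⟩ := hy
        by_cases hyc : y = c
        · exact Or.inl hyc
        · exact Or.inr ⟨hyS, hyY hyc, x, hx.2, hxy⟩
      -- If `F[W]` is connected, a neighbour `c` of the top (any `c` if the stack is empty) is
      -- pushed. By connectedness, `c` touches every component that remains.
      have hstep : ∃ c ∈ W, Inv (W.erase c) := by
        rcases hWp with h | ⟨v, r, p, hp, hpW, hNp, hv⟩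
        · obtain ⟨c, hc⟩ := hWne
          refine ⟨c, hc, (erase_subset _ _).trans hWS, by rw [card_erase_of_mem hc]; omega,
            Or.inr ⟨c, c, Walk.nil, Walk.IsPath.nil, ?_, fun y hy => ?_, htouch c hc⟩⟩
          · simpa using hWS hc
          · rcases hout c hc y hy with rfl | hy
            · simp
            · simp [h] at hy
        · obtain ⟨c, hc, hvc⟩ := hv W (Subset.refl _) hWne (fun _ _ y hy _ => hy)
          refine ⟨c, hc, (erase_subset _ _).trans hWS, by rw [card_erase_of_mem hc]; omega,
            Or.inr ⟨c, r, Walk.cons hvc.symm p, ?_, fun x hx => ?_, fun y hy => ?_,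
              htouch c hc⟩⟩
          · rw [Walk.cons_isPath_iff]
            exact ⟨hp, fun h => (hpW c h).2 hc⟩
          · rw [Walk.support_cons, List.mem_cons] at hx
            rcases hx with rfl | hx
            · exact ⟨hWS hc, notMem_erase _ _⟩
            · exact ⟨(hpW x hx).1, fun h => (hpW x hx).2 (mem_of_mem_erase h)⟩
          · rw [Walk.support_cons, List.mem_cons]
            exact (hout c hc y hy).imp_right (hNp y)
      obtain ⟨c, hc, hInv⟩ := hstep
      exact absurd (hmin _ hInv) (by rw [card_erase_of_mem hc]; omega)
  have hN := hexp W hWS hkW hsmall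
  rcases hWp with h | ⟨v, r, p, hp, hpW, hNp, hv⟩
  · rw [h, card_empty] at hN
    omega
  -- The cycle runs along the stack from `v` to the deepest outer neighbour `u` of `W`, thus through
  -- all outer neighbours, and returns through `W`.
  obtain ⟨u, hu, p', hp', hNp', hpp'⟩ :=
    hp.exists_initial_segment (F.outerNeighbors S W) (card_pos.1 (by omega)) hNp
  obtain ⟨-, -, w, hw, hwu⟩ := mem_filter.1 hu
  obtain ⟨x, hx, hvx, q, hq, hqW⟩ := hv.exists_path hw
  have hvu : v ≠ u := by
    rintro rfl
    have hnil : p' = Walk.nil := (Walk.isPath_iff_nil.1 hp').eq_nil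
    have : F.outerNeighbors S W ⊆ {v} := fun z hz => by simpa [hnil] using hNp' z hz
    have := card_le_card this
    rw [card_singleton] at this
    omega
  obtain ⟨c, hc, hcs⟩ := hp'.exists_isCycle_of_disjoint hq
    (fun z hz hz' => (hpW z (hpp' hz)).2 (hqW z hz')) hvu hwu.symm hvx
  refine ⟨x, c, hc, fun z hz => ?_, hN.trans (card_le_card fun z hz => ?_)⟩
  · rcases (hcs z).1 hz with h | h
    · exact (hpW z (hpp' h)).1
    · exact hWS (hqW z h)
  · rw [List.mem_toFinset, hcs]
    exact Or.inl (hNp' z hz)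

/-- The vertex set of a cycle is a Hamiltonian subset. -/
theorem Walk.IsCycle.isHamiltonianSubset {F G : SimpleGraph V} (hFG : F ≤ G) {v : V}
    {c : F.Walk v v} (hc : c.IsCycle) : G.IsHamiltonianSubset (c.support.toFinset : Set V) := by
  have hmem : ∀ x ∈ (c.mapLe hFG).support, x ∈ (c.support.toFinset : Set V) := by
    intro x hx
    simpa using hx
  refine ⟨⟨v, by simp⟩, (c.mapLe hFG).induce _ hmem, ?_⟩
  have hcyc : ((c.mapLe hFG).induce _ hmem).IsCycle := by
    refine Walk.IsCycle.of_map (f := (Embedding.induce _).toHom) ?_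
    rw [Walk.map_induce]
    exact hc.mapLe hFG
  refine ⟨hcyc, hcyc.isPath_tail.isHamiltonian_of_mem fun a => ?_⟩
  have ha : a ∈ ((c.mapLe hFG).induce _ hmem).support := by
    rw [Walk.support_induce, List.mem_attachWith, Walk.support_mapLe_eq_support]
    exact List.mem_toFinset.1 (mem_coe.1 a.2)
  rw [← Walk.cons_support_tail hcyc.not_nil, List.mem_cons] at ha
  rcases ha with rfl | ha
  · exact Walk.end_mem_support _
  · exact ha

/-! ### Edge counts, and long cycles from density. -/

/-- The number of ordered pairs of adjacent vertices in `S`, which is twice the number of edges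
inside `S`. -/
noncomputable def adjPairs (F : SimpleGraph V) (S : Finset V) : ℕ :=
  #{q ∈ S ×ˢ S | F.Adj q.1 q.2}

theorem adjPairs_le_sq (F : SimpleGraph V) (S : Finset V) : F.adjPairs S ≤ #S * #S :=
  (card_filter_le _ _).trans (card_product _ _).le

theorem adjPairs_mono {F G : SimpleGraph V} (h : F ≤ G) {S T : Finset V} (hST : S ⊆ T) :
    F.adjPairs S ≤ G.adjPairs T :=
  card_le_card fun q hq => by
    simp only [mem_filter, mem_product] at hq ⊢
    exact ⟨⟨hST hq.1.1, hST hq.1.2⟩, h hq.2⟩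

theorem adjPairs_eq_sum (F : SimpleGraph V) (S : Finset V) :
    F.adjPairs S = ∑ x ∈ S, #{y ∈ S | F.Adj x y} := by
  simp only [adjPairs, card_filter, sum_product]

theorem adjPairs_le_adjPairs_sdiff (F : SimpleGraph V) (U R : Finset V) :
    F.adjPairs U ≤ F.adjPairs (U \ R) + 2 * ∑ x ∈ R, #{y ∈ U | F.Adj x y} := by
  have hR : ∑ x ∈ R, #{y ∈ U | F.Adj x y} = #{q ∈ R ×ˢ U | F.Adj q.1 q.2} := by
    simp only [card_filter, sum_product]
  have hR' : #({q ∈ R ×ˢ U | F.Adj q.1 q.2}.image Prod.swap) ≤ #{q ∈ R ×ˢ U | F.Adj q.1 q.2} :=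
    card_image_le
  have hsub : {q ∈ U ×ˢ U | F.Adj q.1 q.2} ⊆ {q ∈ (U \ R) ×ˢ (U \ R) | F.Adj q.1 q.2} ∪
      ({q ∈ R ×ˢ U | F.Adj q.1 q.2} ∪ {q ∈ R ×ˢ U | F.Adj q.1 q.2}.image Prod.swap) := by
    rintro ⟨x, y⟩ hq
    simp only [mem_filter, mem_product] at hq
    simp only [mem_union, mem_filter, mem_product, mem_sdiff, mem_image, Prod.exists,
      Prod.swap_prod_mk, Prod.mk.injEq]
    by_cases hx : x ∈ R
    · exact Or.inr (Or.inl ⟨⟨hx, hq.1.2⟩, hq.2⟩)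
    · by_cases hy : y ∈ R
      · exact Or.inr (Or.inr ⟨y, x, ⟨⟨hy, hq.1.1⟩, hq.2.symm⟩, rfl, rfl⟩)
      · exact Or.inl ⟨⟨⟨hq.1.1, hx⟩, hq.1.2, hy⟩, hq.2⟩
  have h1 := (card_le_card hsub).trans
    ((card_union_le _ _).trans (Nat.add_le_add_left (card_union_le _ _) _))
  rw [hR]
  unfold adjPairs
  omega

/-- A graph of which all sufficiently dense subgraphs have order at least `t` and which has a
subgraph twice as dense contains a cycle of length at least `t / 3`. -/
theorem exists_long_cycle_of_dense [Fintype V] (F : SimpleGraph V) (U : Finset V) {c : ℝ}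
    (hc : 0 < c) {t : ℕ} (ht : 6 ≤ t)
    (hcrux : ∀ X : Finset V, X.Nonempty → c * #X ≤ F.adjPairs X → t ≤ #X)
    (hU : 2 * c * #U < F.adjPairs U) :
    ∃ (v : V) (w : F.Walk v v), w.IsCycle ∧ (∀ x ∈ w.support, x ∈ U) ∧
      t / 3 ≤ #w.support.toFinset := by
  -- In a maximiser `S`, deleting any `X` destroys at least `2 * c * #X` adjacent pairs. This forces
  -- expansion.
  obtain ⟨S, hS, hmax⟩ := exists_max_image U.powerset
    (fun S => (F.adjPairs S : ℝ) - 2 * c * #S) ⟨U, mem_powerset_self U⟩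
  rw [mem_powerset] at hS
  have hSpos : 0 < (F.adjPairs S : ℝ) - 2 * c * #S :=
    lt_of_lt_of_le (sub_pos.2 hU) (hmax U (mem_powerset_self U))
  have hSne : S.Nonempty := by
    rw [nonempty_iff_ne_empty]
    rintro rfl
    simp [adjPairs] at hSpos
  have htS : t ≤ #S := hcrux S hSne (by nlinarith [Nat.cast_nonneg (α := ℝ) #S])
  obtain ⟨v, w, hw, hwS, hwt⟩ := F.exists_long_cycle S (t / 3) (t / 3) (by omega) (by omega)
    (by
      intro X hXS hX hX'
      set N := F.outerNeighbors S X with hN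
      have hNX : Disjoint X N := by
        rw [Finset.disjoint_left]
        intro x hx hxN
        exact (mem_filter.1 hxN).2.1 hx
      have hcard : #(X ∪ N) = #X + #N := card_union_of_disjoint hNX
      by_contra! hlt
      -- Here `#X ≤ 2 * (t / 3)` and `#N < t / 3`, so `X ∪ N` has fewer than `t` vertices and must
      -- be sparse. Since also `#N ≤ #X`, it spans fewer than `2 * c * #X` pairs, although it
      -- contains every edge of `F[S]` meeting `X`.
      have hXN : (F.adjPairs (X ∪ N) : ℝ) < c * #(X ∪ N) := by
        by_contra! h
        have := hcrux _ (Nonempty.mono subset_union_left (card_pos.1 (by omega))) h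
        omega
      have hsub : F.adjPairs S ≤ F.adjPairs (S \ X) + F.adjPairs (X ∪ N) := by
        unfold adjPairs
        refine (card_le_card ?_).trans (card_union_le _ _)
        rintro ⟨x, y⟩ hq
        simp only [mem_filter, mem_product] at hq
        simp only [hN, outerNeighbors, mem_union, mem_filter, mem_product, mem_sdiff]
        obtain ⟨⟨hx, hy⟩, hxy⟩ := hq
        by_cases hxX : x ∈ X
        · by_cases hyX : y ∈ X
          · exact Or.inr ⟨⟨Or.inl hxX, Or.inl hyX⟩, hxy⟩
          · exact Or.inr ⟨⟨Or.inl hxX, Or.inr ⟨hy, hyX, x, hxX, hxy⟩⟩, hxy⟩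
        · by_cases hyX : y ∈ X
          · exact Or.inr ⟨⟨Or.inr ⟨hx, hxX, y, hyX, hxy.symm⟩, Or.inl hyX⟩, hxy⟩
          · exact Or.inl ⟨⟨⟨hx, hxX⟩, hy, hyX⟩, hxy⟩
      have hm := hmax (S \ X) (mem_powerset.2 (sdiff_subset.trans hS))
      have hSX : (#(S \ X) : ℝ) + #X = #S := by
        exact_mod_cast card_sdiff_add_card_eq_card hXS
      have hsub' : (F.adjPairs S : ℝ) ≤ F.adjPairs (S \ X) + F.adjPairs (X ∪ N) := by
        exact_mod_cast hsub
      have hlt' : (#N : ℝ) ≤ #X := by exact_mod_cast (hlt.le.trans hX)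
      rw [hcard] at hXN
      push_cast at hXN
      nlinarith)
  exact ⟨v, w, hw, fun x hx => hS (hwS x hx), hwt⟩

/-! ### Averages over all subsets, and auxiliary inequalities. -/

theorem two_pow_mul_card_superset {S T : Finset V} (hT : T ⊆ S) :
    2 ^ #T * #{U ∈ S.powerset | T ⊆ U} = 2 ^ #S := by
  have : {U ∈ S.powerset | T ⊆ U} = Icc T S := by
    ext U
    simp [and_comm]
  rw [this, card_Icc_finset hT, ← pow_add, Nat.add_sub_cancel' (card_le_card hT)]

theorem two_mul_sum_card_powerset (S : Finset V) :
    2 * ∑ U ∈ S.powerset, #U = 2 ^ #S * #S := by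
  have h : ∀ U ∈ S.powerset, #U = ∑ x ∈ S, if {x} ⊆ U then 1 else 0 := by
    intro U hU
    rw [← card_filter]
    congr 1
    ext x
    simpa using fun hx => mem_powerset.1 hU hx
  rw [sum_congr rfl h, sum_comm, mul_sum]
  simp only [← card_filter]
  rw [sum_congr rfl (fun x hx => ?_), sum_const, smul_eq_mul, mul_comm]
  simpa using two_pow_mul_card_superset (singleton_subset_iff.2 hx)

/-- Both ends of a given edge lie in a uniformly random subset with probability `1 / 4`. -/
theorem four_mul_sum_adjPairs_powerset (F : SimpleGraph V) (S : Finset V) :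
    4 * ∑ U ∈ S.powerset, F.adjPairs U = 2 ^ #S * F.adjPairs S := by
  have h : ∀ U ∈ S.powerset, F.adjPairs U =
      ∑ q ∈ S ×ˢ S with F.Adj q.1 q.2, if {q.1, q.2} ⊆ U then 1 else 0 := by
    intro U hU
    rw [← card_filter, filter_filter, adjPairs]
    congr 1
    ext q
    have := mem_powerset.1 hU
    simp only [mem_filter, mem_product, insert_subset_iff, singleton_subset_iff]
    constructor
    · rintro ⟨⟨h1, h2⟩, h3⟩
      exact ⟨⟨this h1, this h2⟩, h3, h1, h2⟩
    · rintro ⟨-, h3, h1, h2⟩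
      exact ⟨⟨h1, h2⟩, h3⟩
  rw [sum_congr rfl h, sum_comm, mul_sum]
  simp only [← card_filter]
  rw [sum_congr rfl (fun q hq => ?_), sum_const, smul_eq_mul, mul_comm, adjPairs]
  simp only [mem_filter, mem_product] at hq
  have := two_pow_mul_card_superset (S := S) (T := {q.1, q.2})
    (by simp [insert_subset_iff, hq.1.1, hq.1.2])
  rwa [card_pair hq.2.ne] at this

/-- A family in which every small subset of `L` can be avoided by a member that meets `L` is
large. -/
theorem le_card_of_forall_exists_disjoint (𝒜 : Finset (Finset V)) (L : Finset V) (r : ℝ)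
    (h : ∀ R ⊆ L, (#R : ℝ) < r → ∃ A ∈ 𝒜, Disjoint A R ∧ ∃ x ∈ A, x ∈ L) : r ≤ #𝒜 := by
  by_contra! hlt
  -- Choosing one vertex of `L` from each member that meets `L` gives a set `R` that no such member
  -- avoids.
  have hex : ∀ A : {A ∈ 𝒜 | ∃ x ∈ A, x ∈ L}, ∃ x ∈ A.1, x ∈ L := fun A => (mem_filter.1 A.2).2
  choose f hfA hfL using hex
  have hcard : #(univ.image f) ≤ #𝒜 :=
    card_image_le.trans (by simpa using card_filter_le 𝒜 _)
  obtain ⟨A, hA, hdis, hmeet⟩ := h (univ.image f)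
    (fun x hx => by obtain ⟨A, -, rfl⟩ := mem_image.1 hx; exact hfL A)
    (lt_of_le_of_lt (by exact_mod_cast hcard) hlt)
  exact Finset.disjoint_left.1 hdis (hfA ⟨A, mem_filter.2 ⟨hA, hmeet⟩⟩)
    (mem_image_of_mem f (mem_univ _))

/-- Reverse Markov inequality: values below `M / 80` account for at most half of a mean of `M / 40`.
-/
theorem card_le_mul_card_filter_of_sum {ι : Type*} (s : Finset ι) (Y : ι → ℝ) {M : ℝ} (hM : 0 < M)
    (hY : ∀ i ∈ s, Y i ≤ M) (hsum : #s * (M / 40) ≤ ∑ i ∈ s, Y i) :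
    (#s : ℝ) ≤ 80 * #{i ∈ s | M / 80 ≤ Y i} := by
  have h : ∀ i ∈ s, Y i ≤ (if M / 80 ≤ Y i then M else 0) + M / 80 := by
    intro i hi
    split_ifs with h
    · linarith [hY i hi]
    · linarith
  have h2 := hsum.trans (sum_le_sum h)
  rw [sum_add_distrib, ← sum_filter, sum_const, sum_const, nsmul_eq_mul, nsmul_eq_mul] at h2
  have : (#s : ℝ) * M ≤ (80 * #{i ∈ s | M / 80 ≤ Y i}) * M := by linarith
  exact le_of_mul_le_mul_right this hM

theorem sq_le_two_rpow {x : ℝ} (hx : 10 ^ 8 ≤ x) : x ^ 2 ≤ (2 : ℝ) ^ (x / 60) := by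
  have hlog := Real.log_two_gt_d9
  have h0 : 0 ≤ x / 100 := by linarith
  calc x ^ 2 ≤ (x / 100) ^ 3 / (Nat.factorial 3 : ℕ) := by
        norm_num [Nat.factorial]
        nlinarith [sq_nonneg x]
    _ ≤ Real.exp (x / 100) := Real.pow_div_factorial_le_exp _ h0 3
    _ ≤ Real.exp (Real.log 2 * (x / 60)) := Real.exp_le_exp.2 (by nlinarith)
    _ = (2 : ℝ) ^ (x / 60) := (Real.rpow_def_of_pos two_pos _).symm

/-! ### Double counting when the vertices of large degree span few edges. -/

/-- The graph obtained from `G` by deleting all edges inside `T`. -/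
def deleteInside (G : SimpleGraph V) (T : Finset V) : SimpleGraph V where
  Adj x y := G.Adj x y ∧ ¬(x ∈ T ∧ y ∈ T)
  symm := ⟨fun _ _ h => ⟨h.1.symm, fun h' => h.2 h'.symm⟩⟩
  loopless := ⟨fun x h => G.loopless.irrefl x h.1⟩

theorem deleteInside_le (G : SimpleGraph V) (T : Finset V) : G.deleteInside T ≤ G :=
  fun _ _ h => h.1

theorem adjPairs_le_deleteInside_add (G : SimpleGraph V) (S T : Finset V) :
    G.adjPairs S ≤ (G.deleteInside T).adjPairs S + G.adjPairs T := by
  unfold adjPairs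
  refine (card_le_card ?_).trans (card_union_le _ _)
  rintro ⟨x, y⟩ hq
  simp only [mem_filter, mem_product] at hq
  simp only [mem_union, mem_filter, mem_product]
  by_cases h : x ∈ T ∧ y ∈ T
  · exact Or.inr ⟨h, hq.2⟩
  · exact Or.inl ⟨hq.1, hq.2, h⟩

/-- The Hamiltonian subsets of `G` that are contained in `S`. -/
noncomputable def hamiltonianSubsets (G : SimpleGraph V) (S : Finset V) : Finset (Finset V) :=
  S.powerset.filter fun A : Finset V => G.IsHamiltonianSubset (A : Set V)

theorem mem_hamiltonianSubsets {G : SimpleGraph V} {S A : Finset V} :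
    A ∈ G.hamiltonianSubsets S ↔ A ⊆ S ∧ G.IsHamiltonianSubset (A : Set V) := by
  rw [hamiltonianSubsets, mem_filter, mem_powerset]

/-- If the edges inside the set `T` of vertices of large degree are few, then many subsets `U` of
`S` contain many long cycles; double counting the pairs gives many Hamiltonian subsets. -/
theorem card_hamiltonianSubsets_of_sparse [Fintype V] (G : SimpleGraph V) (S T : Finset V)
    {d Φ : ℝ} {t : ℕ} (hd : 0 < d) (hS : S.Nonempty) (hdS : (G.adjPairs S : ℝ) = d * #S)
    (hcrux : ∀ X : Finset V, X.Nonempty → d / 5 * #X ≤ G.adjPairs X → t ≤ #X) (ht : 6 ≤ t)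
    (hΦ : 0 < Φ) (hlow : ∀ x ∈ S \ T, (#{y ∈ S | G.Adj x y} : ℝ) ≤ d * Φ)
    (hT : (G.adjPairs T : ℝ) ≤ d * #S / 10) :
    (2 : ℝ) ^ (t / 3) * #S ≤
      12800 * Φ * #(G.hamiltonianSubsets S) := by
  set F := G.deleteInside T with hF
  have hFG : F ≤ G := G.deleteInside_le T
  have hSpos : (0 : ℝ) < #S := by exact_mod_cast card_pos.2 hS
  have hM : 0 < d * #S := mul_pos hd hSpos
  have hFS : 9 / 10 * (d * #S) ≤ F.adjPairs S := by
    have : (G.adjPairs S : ℝ) ≤ F.adjPairs S + G.adjPairs T := by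
      exact_mod_cast G.adjPairs_le_deleteInside_add S T
    linarith
  let fam : Finset V → Finset (Finset V) := fun U =>
    {A ∈ G.hamiltonianSubsets U | t / 3 ≤ #A}
  let Y : Finset V → ℝ := fun U => (F.adjPairs U : ℝ) - 2 * (d / 5) * #U
  -- a positive proportion of the subsets of `S` span a dense graph
  have hgood : (2 : ℝ) ^ #S ≤ 80 * #{U ∈ S.powerset | d * #S / 80 ≤ Y U} := by
    have h := card_le_mul_card_filter_of_sum S.powerset Y hM (fun U hU => by
      have h1 : (F.adjPairs U : ℝ) ≤ G.adjPairs S := by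
        exact_mod_cast adjPairs_mono hFG (mem_powerset.1 hU)
      have h2 : 0 ≤ 2 * (d / 5) * (#U : ℝ) := by positivity
      simp only [Y]
      linarith) (by
      have h1 : (4 : ℝ) * ∑ U ∈ S.powerset, (F.adjPairs U : ℝ) = 2 ^ #S * F.adjPairs S := by
        exact_mod_cast F.four_mul_sum_adjPairs_powerset S
      have h2 : (2 : ℝ) * ∑ U ∈ S.powerset, (#U : ℝ) = 2 ^ #S * #S := by
        exact_mod_cast two_mul_sum_card_powerset S
      simp only [Y, sum_sub_distrib, ← mul_sum, card_powerset]
      push_cast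
      have h3 : (0 : ℝ) < 2 ^ #S := by positivity
      have h4 := mul_le_mul_of_nonneg_left hFS h3.le
      have h5 : 2 * (d / 5) * ∑ U ∈ S.powerset, (#U : ℝ) = d / 5 * (2 ^ #S * #S) := by
        rw [← h2]; ring
      rw [h5]
      nlinarith)
    simpa using h
  -- every such subset contains many long cycles
  have hmany : ∀ U ∈ {U ∈ S.powerset | d * #S / 80 ≤ Y U}, #S / (160 * Φ) ≤ (#(fam U) : ℝ) := by
    intro U hU
    obtain ⟨hUS, hYU⟩ := mem_filter.1 hU
    rw [mem_powerset] at hUS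
    refine le_card_of_forall_exists_disjoint (fam U) (S \ T) _ fun R hR hRr => ?_
    have hdeg : ((∑ x ∈ R, #{y ∈ U | F.Adj x y} : ℕ) : ℝ) ≤ #R * (d * Φ) := by
      push_cast
      rw [← nsmul_eq_mul]
      refine sum_le_card_nsmul _ _ _ fun x hx => le_trans ?_ (hlow x (hR hx))
      exact_mod_cast card_le_card fun y hy => by
        simp only [mem_filter] at hy ⊢
        exact ⟨hUS hy.1, hFG hy.2⟩
    have hrem : (F.adjPairs U : ℝ) ≤
        F.adjPairs (U \ R) + 2 * (∑ x ∈ R, #{y ∈ U | F.Adj x y} : ℕ) := by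
      exact_mod_cast F.adjPairs_le_adjPairs_sdiff U R
    -- Deleting `R` thus costs fewer than `d * #S / 80` pairs, less than the surplus `Y U`.
    have hRr' : #R * (d * Φ) < d * #S / 160 := by
      rw [lt_div_iff₀ (by positivity)] at hRr
      nlinarith
    have hcardU : (#(U \ R) : ℝ) ≤ #U := by exact_mod_cast card_le_card sdiff_subset
    obtain ⟨v, w, hw, hwU, hwt⟩ := F.exists_long_cycle_of_dense (U \ R) (c := d / 5)
      (by positivity) ht
      (fun X hX h => hcrux X hX (h.trans (by exact_mod_cast adjPairs_mono hFG (Subset.refl X))))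
      (by
        simp only [Y] at hYU
        have := mul_le_mul_of_nonneg_left hcardU (by positivity : 0 ≤ 2 * (d / 5))
        linarith)
    have hsub : w.support.toFinset ⊆ U \ R := fun x hx => hwU x (List.mem_toFinset.1 hx)
    refine ⟨w.support.toFinset, mem_filter.2 ⟨mem_hamiltonianSubsets.2
      ⟨hsub.trans sdiff_subset, hw.isHamiltonianSubset hFG⟩, hwt⟩,
      disjoint_sdiff_self_left.mono_left hsub, ?_⟩
    -- No edge of `F` lies inside `T`, so one end of the first edge of the cycle lies in `S \ T`.
    have hadj : F.Adj v w.snd := w.adj_snd hw.not_nil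
    have hmem : ∀ x ∈ w.support, x ∈ S := fun x hx => hUS (mem_sdiff.1 (hwU x hx)).1
    by_cases hv : v ∈ T
    · refine ⟨w.snd, by simp, mem_sdiff.2 ⟨hmem _ (by simp), fun h => hadj.2 ⟨hv, h⟩⟩⟩
    · exact ⟨v, by simp, mem_sdiff.2 ⟨hmem _ (by simp), hv⟩⟩
  -- every Hamiltonian subset is counted by few subsets
  have hdouble : 2 ^ (t / 3) * ∑ U ∈ S.powerset, #(fam U) ≤
      2 ^ #S * #(G.hamiltonianSubsets S) := by
    have h1 : ∀ U ∈ S.powerset, #(fam U) =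
        ∑ A ∈ G.hamiltonianSubsets S with t / 3 ≤ #A, if A ⊆ U then 1 else 0 := by
      intro U hU
      rw [← card_filter, filter_filter]
      congr 1
      ext A
      simp only [fam, mem_filter, mem_hamiltonianSubsets]
      constructor
      · rintro ⟨⟨h1, h2⟩, h3⟩
        exact ⟨⟨h1.trans (mem_powerset.1 hU), h2⟩, h3, h1⟩
      · rintro ⟨⟨-, h2⟩, h3, h1⟩
        exact ⟨⟨h1, h2⟩, h3⟩
    rw [sum_congr rfl h1, sum_comm, mul_sum]
    simp only [← card_filter]
    refine (sum_le_card_nsmul _ _ (2 ^ #S) fun A hA => ?_).trans ?_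
    · obtain ⟨hAS, hAt⟩ := mem_filter.1 hA
      rw [← two_pow_mul_card_superset (mem_hamiltonianSubsets.1 hAS).1]
      exact Nat.mul_le_mul_right _ (Nat.pow_le_pow_right two_pos hAt)
    · rw [smul_eq_mul, mul_comm]
      refine Nat.mul_le_mul_left _ (card_filter_le _ _)
  set h := #(G.hamiltonianSubsets S)
  have hdouble' : (2 : ℝ) ^ (t / 3) * ∑ U ∈ S.powerset, (#(fam U) : ℝ) ≤ 2 ^ #S * h := by
    exact_mod_cast hdouble
  have hsum : #{U ∈ S.powerset | d * #S / 80 ≤ Y U} * (#S / (160 * Φ)) ≤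
      ∑ U ∈ S.powerset, (#(fam U) : ℝ) := by
    rw [← nsmul_eq_mul]
    exact (card_nsmul_le_sum _ _ _ hmany).trans
      (sum_le_sum_of_subset_of_nonneg (filter_subset _ _) fun _ _ _ => Nat.cast_nonneg _)
  have hpow : (0 : ℝ) < 2 ^ #S := by positivity
  have hkey : (2 : ℝ) ^ #S * (2 ^ (t / 3) * #S) ≤ 2 ^ #S * (12800 * Φ * h) := by
    have h2 : (2 : ℝ) ^ #S / 80 * (#S / (160 * Φ)) ≤ ∑ U ∈ S.powerset, (#(fam U) : ℝ) :=
      le_trans (mul_le_mul_of_nonneg_right (by linarith) (by positivity)) hsum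
    have h3 := (mul_le_mul_of_nonneg_left h2
      (by positivity : (0 : ℝ) ≤ 2 ^ (t / 3))).trans hdouble'
    have h4 := mul_le_mul_of_nonneg_left h3 (by positivity : (0 : ℝ) ≤ 12800 * Φ)
    calc (2 : ℝ) ^ #S * (2 ^ (t / 3) * #S)
        = 12800 * Φ * (2 ^ (t / 3) * (2 ^ #S / 80 * (#S / (160 * Φ)))) := by
          field_simp; norm_num
      _ ≤ _ := h4
      _ = _ := by ring
  exact le_of_mul_le_mul_left hkey hpow

/-! ### Induction onto the vertices of large degree. -/

/-- The lower bound `|S| 2 ^ (t / 12) / 12800` for the number of Hamiltonian subsets of `G[S]`. -/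
theorem card_mul_two_rpow_le_card_hamiltonianSubsets [Fintype V] (G : SimpleGraph V) (m : ℕ) :
    ∀ (S : Finset V), #S = m → S.Nonempty → ∀ (d : ℝ) (t : ℕ), 10 ^ 8 ≤ d →
      (G.adjPairs S : ℝ) = d * #S → d / 5 ≤ t →
      (∀ X : Finset V, X.Nonempty → d / 5 * #X ≤ G.adjPairs X → t ≤ #X) →
      #S * (2 : ℝ) ^ ((t : ℝ) / 12) ≤
        12800 * #(G.hamiltonianSubsets S) := by
  induction m using Nat.strong_induction_on with
  | _ m ih =>
  intro S hSm hS d t hd hdS hdt hcrux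
  set Φ : ℝ := (2 : ℝ) ^ ((t : ℝ) / 12) with hΦdef
  have ht : (10 : ℝ) ^ 7 ≤ t := by linarith
  have hΦ : 100 ≤ Φ := by
    have h1 : (2 : ℝ) ^ (7 : ℝ) ≤ Φ :=
      Real.rpow_le_rpow_of_exponent_le one_le_two (by linarith)
    norm_num at h1
    linarith
  have hdpos : 0 < d := by linarith
  have hSpos : (0 : ℝ) < #S := by exact_mod_cast card_pos.2 hS
  set T := {x ∈ S | d * Φ < #{y ∈ S | G.Adj x y}} with hT
  by_cases hsparse : (G.adjPairs T : ℝ) ≤ d * #S / 10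
  · have ht6 : 6 ≤ t := by
      have : (6 : ℝ) ≤ t := by linarith
      exact_mod_cast this
    have h := G.card_hamiltonianSubsets_of_sparse S T hdpos hS hdS hcrux ht6
      (by linarith : 0 < Φ) (fun x hx => by
        simp only [hT, mem_sdiff, mem_filter, not_and, not_lt] at hx
        exact hx.2 hx.1) hsparse
    -- One factor `Φ` pays for the degree bound and the other is the desired gain; the slack absorbs
    -- the rounding in `t / 3`.
    have hsq : Φ * Φ ≤ (2 : ℝ) ^ (t / 3) := by
      rw [hΦdef, ← Real.rpow_add two_pos, ← Real.rpow_natCast]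
      refine Real.rpow_le_rpow_of_exponent_le one_le_two ?_
      have : (t : ℝ) ≤ 6 * (t / 3 : ℕ) := by exact_mod_cast (by omega : t ≤ 6 * (t / 3))
      linarith
    have h2 := (mul_le_mul_of_nonneg_right hsq hSpos.le).trans h
    refine le_of_mul_le_mul_left (a := Φ) ?_ (by linarith)
    linarith
  · push Not at hsparse
    have hTne : T.Nonempty := by
      rw [nonempty_iff_ne_empty]
      intro h
      simp only [h, adjPairs, product_empty, filter_empty, card_empty, Nat.cast_zero] at hsparse
      nlinarith
    have hTpos : (0 : ℝ) < #T := by exact_mod_cast card_pos.2 hTne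
    have hTS : T ⊆ S := filter_subset _ _
    have hTcard : #T * Φ ≤ #S := by
      have h1 : (#T : ℝ) * (d * Φ) ≤ d * #S := by
        rw [← hdS, adjPairs_eq_sum, ← nsmul_eq_mul]
        push_cast
        refine (card_nsmul_le_sum T (fun x => (#{y ∈ S | G.Adj x y} : ℝ)) _ fun x hx =>
          (mem_filter.1 hx).2.le).trans ?_
        exact sum_le_sum_of_subset_of_nonneg hTS fun _ _ _ => Nat.cast_nonneg _
      refine le_of_mul_le_mul_left (a := d) ?_ hdpos
      linarith
    set D : ℝ := G.adjPairs T / #T with hD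
    have hDT : (G.adjPairs T : ℝ) = D * #T := by rw [hD]; field_simp
    have hDΦ : d * Φ / 10 ≤ D := by
      rw [hD, le_div_iff₀ hTpos]
      nlinarith
    have hDd : d ≤ D := by nlinarith
    have hDlarge : (10 : ℝ) ^ 8 ≤ D := hd.trans hDd
    have hlt : #T < m := by
      have : (#T : ℝ) < #S := by nlinarith
      rw [← hSm]
      exact_mod_cast this
    -- The parameter `⌈D / 5⌉₊` is always admissible: average degree at least `D / 5` needs at least
    -- `D / 5` vertices.
    have h := ih #T hlt T rfl hTne D ⌈D / 5⌉₊ hDlarge hDT (Nat.le_ceil _) (fun X hX hXD => by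
      have hXpos : (0 : ℝ) < #X := by exact_mod_cast card_pos.2 hX
      have h1 : (G.adjPairs X : ℝ) ≤ #X * #X := by exact_mod_cast G.adjPairs_le_sq X
      exact Nat.ceil_le.2 (le_of_mul_le_mul_right (hXD.trans h1) hXpos))
    have h1 : D ^ 2 ≤ (2 : ℝ) ^ ((⌈D / 5⌉₊ : ℝ) / 12) :=
      (sq_le_two_rpow hDlarge).trans (Real.rpow_le_rpow_of_exponent_le one_le_two (by
        linarith [Nat.le_ceil (D / 5)]))
    have h2 : (#(G.hamiltonianSubsets T) : ℝ) ≤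
        #(G.hamiltonianSubsets S) := by
      exact_mod_cast card_le_card (filter_subset_filter _ (powerset_mono.2 hTS))
    -- One factor `D` makes up for `T` being smaller than `S`, the other for `Φ`; the gain `2 ^ (D /
    -- 60)` exceeds both together.
    have h3 : #S * Φ ≤ #T * D ^ 2 := by
      have h4 : (#S : ℝ) ≤ D * #T := by
        have := mul_le_mul_of_nonneg_right hd hSpos.le
        linarith
      have h5 : Φ ≤ D := by
        have := mul_le_mul_of_nonneg_right hd (by linarith : 0 ≤ Φ)
        linarith
      have h6 : 0 ≤ D * #T := hSpos.le.trans h4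
      calc #S * Φ ≤ (D * #T) * D := mul_le_mul h4 h5 (by linarith) h6
        _ = _ := by ring
    have h4 := mul_le_mul_of_nonneg_left h1 hTpos.le
    linarith

/-! ### Translation to average degree, crux size and `numHamiltonianSubsets`. -/

/-- Twice the number of edges is the number of ordered pairs of adjacent vertices. -/
theorem two_mul_ncard_edgeSet [Fintype V] (G : SimpleGraph V) :
    2 * G.edgeSet.ncard = G.adjPairs univ := by
  rw [← coe_edgeFinset, Set.ncard_coe_finset, ← sum_degrees_eq_twice_card_edges, adjPairs_eq_sum]
  refine sum_congr rfl fun x _ => ?_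
  rw [← card_neighborFinset_eq_degree]
  congr 1
  ext y
  simp

theorem adjPairs_eq_two_mul_ncard_edgeSet_induce [Fintype V] (G : SimpleGraph V) (X : Finset V) :
    G.adjPairs X = 2 * ((⊤ : G.Subgraph).induce (X : Set V)).coe.edgeSet.ncard := by
  rw [two_mul_ncard_edgeSet, adjPairs, adjPairs]
  refine (card_bij (fun q _ => (q.1.1, q.2.1)) ?_ ?_ ?_).symm
  · rintro ⟨⟨x, hx⟩, ⟨y, hy⟩⟩ h
    simp only [Subgraph.induce_verts, mem_coe] at hx hy
    simp_all
  · rintro ⟨⟨x, hx⟩, ⟨y, hy⟩⟩ _ ⟨⟨x', hx'⟩, ⟨y', hy'⟩⟩ _ h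
    simpa using h
  · rintro ⟨x, y⟩ h
    simp only [mem_filter, mem_product] at h
    exact ⟨(⟨x, h.1.1⟩, ⟨y, h.1.2⟩), by simp [h], rfl⟩

theorem cruxSize_le_card [Fintype V] (G : SimpleGraph V) {α : ℝ} {X : Finset V} (hX : X.Nonempty)
    (h : α * G.avgDegree * #X ≤ G.adjPairs X) : G.cruxSize α ≤ #X := by
  refine Nat.sInf_le ⟨(⊤ : G.Subgraph).induce (X : Set V), ⟨by simpa using hX, ?_⟩, by simp⟩
  have hXpos : (0 : ℝ) < #X := by exact_mod_cast card_pos.2 hX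
  have hcard : Nat.card ((⊤ : G.Subgraph).induce (X : Set V)).verts = #X := by simp
  rw [adjPairs_eq_two_mul_ncard_edgeSet_induce] at h
  push_cast at h
  rw [avgDegree, avgDegree, hcard, le_div_iff₀ hXpos]
  exact h

theorem numHamiltonianSubsets_eq [Fintype V] (G : SimpleGraph V) :
    G.numHamiltonianSubsets = #(G.hamiltonianSubsets univ) := by
  rw [numHamiltonianSubsets, ← Set.ncard_coe_finset]
  symm
  refine Set.ncard_congr (fun A _ => (A : Set V)) ?_ ?_ ?_
  · intro A hA
    exact (mem_hamiltonianSubsets.1 hA).2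
  · intro A B _ _ h
    exact coe_injective h
  · intro A hA
    exact ⟨A.toFinset, mem_hamiltonianSubsets.2 ⟨subset_univ _, by simpa using hA⟩, by simp⟩

end SimpleGraph

/-! ### The exponent, and the conclusion. -/

theorem beta_mul_div_log_pow_le {β : ℝ} (hβ : β = ((6000 * Real.log 3) ^ 16)⁻¹) (t : ℕ) :
    β * (t : ℝ) / Real.log (t : ℝ) ^ 16 ≤ (t : ℝ) / 12 := by
  rcases Nat.lt_or_ge t 2 with ht | ht
  -- For `t` equal to `0` or `1` the logarithm is `0`, and division by zero makes the left side `0`.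
  · interval_cases t <;> simp
  have ht' : (2 : ℝ) ≤ t := by exact_mod_cast ht
  have hlog2 := Real.log_two_gt_d9
  have hlog : 1 / 2 ≤ Real.log t := by
    linarith [Real.log_le_log two_pos ht']
  have hlog3 : 1 / 2 ≤ Real.log 3 := by
    linarith [Real.log_le_log two_pos (by norm_num : (2 : ℝ) ≤ 3)]
  have h1 : (1 / 2 : ℝ) ^ 16 ≤ Real.log t ^ 16 := pow_le_pow_left₀ (by norm_num) hlog 16
  have h2 : (3000 : ℝ) ^ 16 ≤ (6000 * Real.log 3) ^ 16 :=
    pow_le_pow_left₀ (by norm_num) (by linarith) 16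
  have h3 : β ≤ ((3000 : ℝ) ^ 16)⁻¹ := by
    rw [hβ]
    exact inv_anti₀ (by positivity) h2
  rw [div_le_iff₀ (lt_of_lt_of_le (by positivity) h1)]
  have h4 := mul_le_mul_of_nonneg_right h3 (by linarith : (0 : ℝ) ≤ t)
  have h5 := mul_le_mul_of_nonneg_left h1 (by linarith : (0 : ℝ) ≤ (t : ℝ) / 12)
  refine h4.trans (le_trans ?_ h5)
  norm_num
  linarith

theorem theorem1p1 :
    ∃ B d₀ : ℝ, 0 < B ∧
      ∀ (V : Type*) [Fintype V] (G : SimpleGraph V) (t : ℕ) (β : ℝ),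
        d₀ ≤ G.avgDegree →
        t = G.cruxSize (1 / 5) →
        β = ((6000 * Real.log 3) ^ 16)⁻¹ →
        1 / B * (Fintype.card V : ℝ) * (2 : ℝ) ^ (β * (t : ℝ) / Real.log (t : ℝ) ^ 16)
          ≤ (G.numHamiltonianSubsets : ℝ) := by
  refine ⟨12800, 10 ^ 8, by norm_num, fun V _ G t β hd ht hβ => ?_⟩
  rcases isEmpty_or_nonempty V with hV | hV
  · simp
  have hVpos : (0 : ℝ) < Fintype.card V := by exact_mod_cast Fintype.card_pos
  have hpairs : (G.adjPairs univ : ℝ) = G.avgDegree * #(univ : Finset V) := by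
    rw [← SimpleGraph.two_mul_ncard_edgeSet, SimpleGraph.avgDegree, Nat.card_eq_fintype_card,
      card_univ]
    push_cast
    field_simp
  have h := G.card_mul_two_rpow_le_card_hamiltonianSubsets _ univ rfl univ_nonempty G.avgDegree
    -- The maximum supplies the required lower bound `d / 5` on the parameter without comparing it
    -- to the crux size.
    (max t ⌈G.avgDegree / 5⌉₊) hd hpairs
    ((Nat.le_ceil _).trans (by exact_mod_cast le_max_right _ _)) (fun X hX hXd => by
      have hXpos : (0 : ℝ) < #X := by exact_mod_cast card_pos.2 hX
      refine max_le ?_ ?_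
      · rw [ht]
        exact G.cruxSize_le_card hX (le_of_eq_of_le (by ring) hXd)
      · have h1 : (G.adjPairs X : ℝ) ≤ #X * #X := by exact_mod_cast G.adjPairs_le_sq X
        exact Nat.ceil_le.2 (le_of_mul_le_mul_right (hXd.trans h1) hXpos))
  rw [← SimpleGraph.numHamiltonianSubsets_eq, card_univ] at h
  have hexp : (2 : ℝ) ^ (β * (t : ℝ) / Real.log (t : ℝ) ^ 16) ≤
      (2 : ℝ) ^ (((max t ⌈G.avgDegree / 5⌉₊ : ℕ) : ℝ) / 12) := by
    refine Real.rpow_le_rpow_of_exponent_le one_le_two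
      ((beta_mul_div_log_pow_le hβ t).trans ?_)
    have : (t : ℝ) ≤ (max t ⌈G.avgDegree / 5⌉₊ : ℕ) := by exact_mod_cast le_max_left _ _
    linarith
  have := mul_le_mul_of_nonneg_left hexp hVpos.le
  linarith
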